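/- Let $n\ge 2$ and let $q\in\mathbb C$ be a primitive $n$-th root of unity. Let $u_q(sl_2)$ be the unital $\mathbb C$-algebra with generators $K,E,F$ and relations $$K^n=1,\quad E^n=F^n=0,\quad EK=qKE,\quad FK=q^{-1}KF,\quad [E,F]=\frac{K-K^{-1}}{q-q^{-1}},$$ where for $n=2$ (so $q=-1$, $K=K^{-1}$) the last relation is read as $[E,F]=0$. It has the coproduct $\Delta K=K\otimes K$, $\Delta E=E\otimes K+1\otimes E$, $\Delta F=F\otimes 1+K^{-1}\otimes F$, with counit $K\mapsto 1$, $E,F\mapsto 0$. The monomials $K^iF^jE^k$, $0\le i,j,k\le n-1$, form a basis of $u_q(sl_2)$. There is a unique linear functional $\int:u_q(sl_2)\to\mathbb C$ such that $(\int\otimes\mathrm{id})\Delta(x)=(\int x)\,1$ for all $x$ and $\int KF^{n-1}E^{n-1}=1$; it is zero on all other elements of the monomial basis. Twisting it by $K$, the bilinear form $$(h,g)=\int Khg$$ is a symmetric Frobenius form on $u_q(sl_2)$: $(ab,c)=(a,bc)$ for all $a,b,c$; the map $a\mapsto(a,\cdot\,)$ from $u_q(sl_2)$ to its dual is bijective;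 and $(h,g)=(g,h)$ for all $h,g$. -/

import Mathlib

open scoped TensorProduct

namespace QuantumSL2

/-! ### Frobenius forms, twisting, and integrals -/

section General

variable {𝕜 A : Type*} [Field 𝕜] [Ring A] [Algebra 𝕜 A]

/-- A Frobenius form on an algebra: a bilinear form with `(ab, c) = (a, bc)` that is invertible,
i.e. `a ↦ (a, ·)` is a bijection of `A` onto its dual. -/
structure IsFrobeniusForm (B : LinearMap.BilinForm 𝕜 A) : Prop where
  assoc : ∀ a b c : A, B (a * b) c = B a (b * c)
  bijective : Function.Bijective (fun a : A => (B a : Module.Dual 𝕜 A))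

/-- The bilinear form `(h, g) = φ(u h g)` got from a linear functional `φ` by twisting by `u`. -/
def twistedForm (φ : A →ₗ[𝕜] 𝕜) (u : A) : LinearMap.BilinForm 𝕜 A :=
  LinearMap.mk₂ 𝕜 (fun h g => φ (u * h * g))
    (fun h h' g => by simp only [mul_add, add_mul, map_add])
    (fun c h g => by simp only [mul_smul_comm, smul_mul_assoc, map_smul])
    (fun h g g' => by simp only [mul_add, map_add])
    (fun c h g => by simp only [mul_smul_comm, map_smul])

/-- `φ : H → 𝕜` is an integral on the bialgebra `H` if `(φ ⊗ id) Δ(x) = φ(x) 1` for all `x`. -/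
def IsHopfIntegral {H : Type*} [Ring H] [Bialgebra 𝕜 H] (φ : H →ₗ[𝕜] 𝕜) : Prop :=
  ∀ x : H, TensorProduct.lid 𝕜 H (φ.rTensor H (Coalgebra.comul (R := 𝕜) x)) = φ x • (1 : H)

end General

/-! ### A vanishing property of powers of `q`-commuting elements -/

section QBinomial

/-- The Gaussian binomial coefficients. -/
def qChoose (q : ℂ) : ℕ → ℕ → ℂ
  | _, 0 => 1
  | 0, _ + 1 => 0
  | m + 1, k + 1 => qChoose q m k + q ^ (k + 1) * qChoose q m (k + 1)

/-- `∏_{t=1}^m (1 - q^t)`. -/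
def qFact (q : ℂ) (m : ℕ) : ℂ := ∏ t ∈ Finset.range m, (1 - q ^ (t + 1))

theorem qChoose_eq_zero (q : ℂ) : ∀ m k : ℕ, m < k → qChoose q m k = 0
  | _, 0, h => by omega
  | 0, _ + 1, _ => by simp [qChoose]
  | m + 1, k + 1, h => by
    rw [qChoose, qChoose_eq_zero q m k (by omega), qChoose_eq_zero q m (k + 1) (by omega)]
    simp

theorem qChoose_mul_qFact (q : ℂ) : ∀ m i j : ℕ, i + j = m →
    qChoose q m i * (qFact q i * qFact q j) = qFact q m := by
  intro m
  induction m with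
  | zero =>
    intro i j h
    obtain ⟨rfl, rfl⟩ : i = 0 ∧ j = 0 := by omega
    simp [qChoose, qFact]
  | succ m ih =>
    intro i j h
    rcases i with _ | i
    · obtain rfl : j = m + 1 := by omega
      simp [qChoose, qFact]
    rcases j with _ | j
    · obtain rfl : i = m := by omega
      have h0 := ih i 0 (by omega)
      have hz : qChoose q i (i + 1) = 0 := qChoose_eq_zero q _ _ (by omega)
      rw [qChoose, hz]
      simp only [qFact, Finset.prod_range_succ, Finset.prod_range_zero] at h0 ⊢
      linear_combination (1 - q ^ (i + 1)) * h0
    · have h1 := ih i (j + 1) (by omega)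
      have h2 := ih (i + 1) j (by omega)
      have hm : m = i + j + 1 := by omega
      subst hm
      rw [qChoose]
      simp only [qFact, Finset.prod_range_succ] at h1 h2 ⊢
      linear_combination (1 - q ^ (i + 1)) * h1 + q ^ (i + 1) * (1 - q ^ (j + 1)) * h2

variable {A : Type*} [Ring A] [Algebra ℂ A]

theorem qcomm_pow {q : ℂ} {x y : A} (h : y * x = q • (x * y)) (k : ℕ) :
    y * x ^ k = q ^ k • (x ^ k * y) := by
  induction k with
  | zero => simp
  | succ k ih =>
    rw [pow_succ, ← mul_assoc, ih, smul_mul_assoc, mul_assoc, h, mul_smul_comm, smul_smul,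
      ← mul_assoc, pow_succ]

theorem qcomm_add_pow {q : ℂ} {x y : A} (h : y * x = q • (x * y)) (m : ℕ) :
    (x + y) ^ m = ∑ k ∈ Finset.range (m + 1), qChoose q m k • (x ^ k * y ^ (m - k)) := by
  induction m with
  | zero => simp [qChoose]
  | succ m ih =>
    have e1 : x * (x + y) ^ m =
        ∑ k ∈ Finset.range (m + 1), qChoose q m k • (x ^ (k + 1) * y ^ (m - k)) := by
      rw [ih, Finset.mul_sum]
      refine Finset.sum_congr rfl fun k _ => ?_
      rw [mul_smul_comm, ← mul_assoc, pow_succ']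
    have e2 : y * (x + y) ^ m =
        ∑ k ∈ Finset.range (m + 2),
          (q ^ k * qChoose q m k) • (x ^ k * y ^ (m + 1 - k)) := by
      rw [Finset.sum_range_succ, qChoose_eq_zero q m (m + 1) (by omega), mul_zero, zero_smul,
        add_zero, ih, Finset.mul_sum]
      refine Finset.sum_congr rfl fun k hk => ?_
      have hk' : m + 1 - k = (m - k) + 1 := by
        have := Finset.mem_range.1 hk
        omega
      rw [mul_smul_comm, ← mul_assoc, qcomm_pow h, smul_mul_assoc, smul_smul, mul_assoc,
        ← pow_succ', hk', mul_comm]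
    rw [pow_succ', add_mul, e1, e2, Finset.sum_range_succ' _ (m + 1),
      Finset.sum_range_succ' _ (m + 1), ← add_assoc, ← Finset.sum_add_distrib]
    congr 1
    · refine Finset.sum_congr rfl fun k _ => ?_
      rw [Nat.add_sub_add_right, ← add_smul, qChoose]
    · simp [qChoose]

theorem qcomm_add_pow_eq_zero {n : ℕ} {q : ℂ} (hq : IsPrimitiveRoot q n) {x y : A}
    (h : y * x = q • (x * y)) (hx : x ^ n = 0) (hy : y ^ n = 0) : (x + y) ^ n = 0 := by
  rw [qcomm_add_pow h]
  refine Finset.sum_eq_zero fun k hk => ?_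
  have hk' := Finset.mem_range.1 hk
  rcases Nat.eq_zero_or_pos k with rfl | hk0
  · simp [hy]
  rcases Nat.lt_or_ge k n with hkn | hkn
  · have hne : ∀ i, i < n → qFact q i ≠ 0 := by
      intro i hi
      refine Finset.prod_ne_zero_iff.2 fun t ht => ?_
      have ht' := Finset.mem_range.1 ht
      exact sub_ne_zero.2 (hq.pow_ne_one_of_pos_of_lt (by omega) (by omega)).symm
    have h1 := qChoose_mul_qFact q n k (n - k) (by omega)
    have h2 : qFact q n = 0 := by
      refine Finset.prod_eq_zero (i := n - 1) (Finset.mem_range.2 (by omega)) ?_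
      rw [Nat.sub_add_cancel (by omega), hq.pow_eq_one, sub_self]
    rw [h2] at h1
    have h3 : qChoose q n k = 0 :=
      (mul_eq_zero.1 h1).resolve_right
        (mul_ne_zero (hne k hkn) (hne (n - k) (by omega)))
    rw [h3, zero_smul]
  · obtain rfl : k = n := by omega
    simp [hx]

end QBinomial

/-! ### The reduced quantum group -/

/-- The names of the generators. -/
inductive Gen
  | K | E | F

/-- The defining relations, `K^(n-1)` playing the role of `K⁻¹`.  For `n = 2`, `q = -1` both
`K - K⁻¹` and `q - q⁻¹` vanish; since `0⁻¹ = 0`, the last relation then reads `[E, F] = 0`. -/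
inductive Relation (n : ℕ) (q : ℂ) : FreeAlgebra ℂ Gen → FreeAlgebra ℂ Gen → Prop
  | K_pow : Relation n q (FreeAlgebra.ι ℂ Gen.K ^ n) 1
  | E_pow : Relation n q (FreeAlgebra.ι ℂ Gen.E ^ n) 0
  | F_pow : Relation n q (FreeAlgebra.ι ℂ Gen.F ^ n) 0
  | E_K : Relation n q (FreeAlgebra.ι ℂ Gen.E * FreeAlgebra.ι ℂ Gen.K)
      (q • (FreeAlgebra.ι ℂ Gen.K * FreeAlgebra.ι ℂ Gen.E))
  | F_K : Relation n q (FreeAlgebra.ι ℂ Gen.F * FreeAlgebra.ι ℂ Gen.K)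
      (q⁻¹ • (FreeAlgebra.ι ℂ Gen.K * FreeAlgebra.ι ℂ Gen.F))
  | E_F : Relation n q
      (FreeAlgebra.ι ℂ Gen.E * FreeAlgebra.ι ℂ Gen.F
        - FreeAlgebra.ι ℂ Gen.F * FreeAlgebra.ι ℂ Gen.E)
      ((q - q⁻¹)⁻¹ • (FreeAlgebra.ι ℂ Gen.K - FreeAlgebra.ι ℂ Gen.K ^ (n - 1)))

/-- The algebra `u_q(sl₂)`, for `q` a primitive `n`-th root of unity. -/
def Uq (n : ℕ) (q : ℂ) : Type := RingQuot (Relation n q)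

namespace Uq

noncomputable instance (n : ℕ) (q : ℂ) : Ring (Uq n q) :=
  inferInstanceAs (Ring (RingQuot (Relation n q)))

noncomputable instance (n : ℕ) (q : ℂ) : Algebra ℂ (Uq n q) :=
  inferInstanceAs (Algebra ℂ (RingQuot (Relation n q)))

/-- The quotient map from the free algebra. -/
noncomputable def mk (n : ℕ) (q : ℂ) : FreeAlgebra ℂ Gen →ₐ[ℂ] Uq n q :=
  RingQuot.mkAlgHom ℂ (Relation n q)

theorem mk_rel {n : ℕ} {q : ℂ} {x y : FreeAlgebra ℂ Gen} (h : Relation n q x y) :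
    mk n q x = mk n q y :=
  RingQuot.mkAlgHom_rel ℂ h

/-- The image of a generator. -/
noncomputable def gen (n : ℕ) (q : ℂ) (g : Gen) : Uq n q :=
  mk n q (FreeAlgebra.ι ℂ g)

/-- The generator `K`. -/
noncomputable abbrev K (n : ℕ) (q : ℂ) : Uq n q := gen n q Gen.K

/-- The generator `E`. -/
noncomputable abbrev E (n : ℕ) (q : ℂ) : Uq n q := gen n q Gen.E

/-- The generator `F`. -/
noncomputable abbrev F (n : ℕ) (q : ℂ) : Uq n q := gen n q Gen.F

theorem K_pow (n : ℕ) (q : ℂ) : K n q ^ n = 1 := by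
  simpa [gen] using mk_rel (Relation.K_pow (n := n) (q := q))

theorem E_pow (n : ℕ) (q : ℂ) : E n q ^ n = 0 := by
  simpa [gen] using mk_rel (Relation.E_pow (n := n) (q := q))

theorem F_pow (n : ℕ) (q : ℂ) : F n q ^ n = 0 := by
  simpa [gen] using mk_rel (Relation.F_pow (n := n) (q := q))

theorem E_mul_K (n : ℕ) (q : ℂ) : E n q * K n q = q • (K n q * E n q) := by
  simpa [gen] using mk_rel (Relation.E_K (n := n) (q := q))

theorem F_mul_K (n : ℕ) (q : ℂ) : F n q * K n q = q⁻¹ • (K n q * F n q) := by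
  simpa [gen] using mk_rel (Relation.F_K (n := n) (q := q))

theorem E_F_comm (n : ℕ) (q : ℂ) : E n q * F n q - F n q * E n q =
    (q - q⁻¹)⁻¹ • (K n q - K n q ^ (n - 1)) := by
  simpa [gen] using mk_rel (Relation.E_F (n := n) (q := q))

section Lift

variable {n : ℕ} {q : ℂ} {B : Type*} [Ring B] [Algebra ℂ B]

/-- The algebra map out of `u_q(sl₂)` given by elements that satisfy the defining relations. -/
noncomputable def lift (k e f : B) (hk : k ^ n = 1) (he : e ^ n = 0) (hf : f ^ n = 0)
    (hek : e * k = q • (k * e)) (hfk : f * k = q⁻¹ • (k * f))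
    (hef : e * f - f * e = (q - q⁻¹)⁻¹ • (k - k ^ (n - 1))) : Uq n q →ₐ[ℂ] B :=
  RingQuot.liftAlgHom ℂ
    ⟨FreeAlgebra.lift ℂ (fun g => match g with | Gen.K => k | Gen.E => e | Gen.F => f), by
      intro x y h
      cases h <;> simp [hk, he, hf, hek, hfk, hef]⟩

theorem lift_gen (k e f : B) (hk : k ^ n = 1) (he : e ^ n = 0) (hf : f ^ n = 0)
    (hek : e * k = q • (k * e)) (hfk : f * k = q⁻¹ • (k * f))
    (hef : e * f - f * e = (q - q⁻¹)⁻¹ • (k - k ^ (n - 1))) :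
    lift k e f hk he hf hek hfk hef (K n q) = k ∧
    lift k e f hk he hf hek hfk hef (E n q) = e ∧
    lift k e f hk he hf hek hfk hef (F n q) = f := by
  refine ⟨?_, ?_, ?_⟩ <;>
  · refine (RingQuot.liftAlgHom_mkAlgHom_apply ℂ _ _ _).trans ?_
    simp

theorem hom_ext {f g : Uq n q →ₐ[ℂ] B} (hK : f (K n q) = g (K n q))
    (hE : f (E n q) = g (E n q)) (hF : f (F n q) = g (F n q)) : f = g := by
  refine RingQuot.ringQuot_ext' ℂ _ _ (FreeAlgebra.hom_ext ?_)
  funext x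
  cases x
  · exact hK
  · exact hE
  · exact hF

end Lift

section Bialgebra

variable {n : ℕ} {q : ℂ}

theorem K_mul_Kinv (hn : 2 ≤ n) : K n q * K n q ^ (n - 1) = 1 := by
  rw [← pow_succ', Nat.sub_add_cancel (by omega), K_pow]

theorem Kinv_mul_K (hn : 2 ≤ n) : K n q ^ (n - 1) * K n q = 1 := by
  rw [← pow_succ, Nat.sub_add_cancel (by omega), K_pow]

theorem F_mul_Kinv (hn : 2 ≤ n) (hq : IsPrimitiveRoot q n) :
    F n q * K n q ^ (n - 1) = q • (K n q ^ (n - 1) * F n q) := by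
  have hq0 : q ≠ 0 := hq.ne_zero (by omega)
  calc F n q * K n q ^ (n - 1)
      = K n q ^ (n - 1) * (K n q * F n q) * K n q ^ (n - 1) := by
        rw [← mul_assoc, Kinv_mul_K hn, one_mul]
    _ = q • (K n q ^ (n - 1) * (F n q * K n q) * K n q ^ (n - 1)) := by
        rw [F_mul_K, mul_smul_comm, smul_mul_assoc, smul_smul, mul_inv_cancel₀ hq0, one_smul]
    _ = q • (K n q ^ (n - 1) * F n q) := by
        rw [mul_assoc, mul_assoc, K_mul_Kinv hn, mul_one]

theorem E_mul_Kinv (hn : 2 ≤ n) (hq : IsPrimitiveRoot q n) :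
    E n q * K n q ^ (n - 1) = q⁻¹ • (K n q ^ (n - 1) * E n q) := by
  have hq0 : q ≠ 0 := hq.ne_zero (by omega)
  calc E n q * K n q ^ (n - 1)
      = K n q ^ (n - 1) * (K n q * E n q) * K n q ^ (n - 1) := by
        rw [← mul_assoc, Kinv_mul_K hn, one_mul]
    _ = q⁻¹ • (K n q ^ (n - 1) * (E n q * K n q) * K n q ^ (n - 1)) := by
        rw [E_mul_K, mul_smul_comm, smul_mul_assoc, smul_smul, inv_mul_cancel₀ hq0, one_smul]
    _ = q⁻¹ • (K n q ^ (n - 1) * E n q) := by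
        rw [mul_assoc, mul_assoc, K_mul_Kinv hn, mul_one]

/-- The coproduct: `ΔK = K ⊗ K`, `ΔE = E ⊗ K + 1 ⊗ E`, `ΔF = F ⊗ 1 + K⁻¹ ⊗ F`. -/
noncomputable def comul (hn : 2 ≤ n) (hq : IsPrimitiveRoot q n) : Uq n q →ₐ[ℂ] Uq n q ⊗[ℂ] Uq n q :=
  lift (K n q ⊗ₜ[ℂ] K n q)
    (E n q ⊗ₜ[ℂ] K n q + 1 ⊗ₜ[ℂ] E n q)
    (F n q ⊗ₜ[ℂ] 1 + (K n q ^ (n - 1)) ⊗ₜ[ℂ] F n q)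
    (by rw [Algebra.TensorProduct.tmul_pow, K_pow, Algebra.TensorProduct.one_def])
    (by
      apply qcomm_add_pow_eq_zero hq
      · simp only [Algebra.TensorProduct.tmul_mul_tmul, one_mul, mul_one, E_mul_K,
          TensorProduct.tmul_smul]
      · rw [Algebra.TensorProduct.tmul_pow, E_pow, TensorProduct.zero_tmul]
      · rw [Algebra.TensorProduct.tmul_pow, E_pow, TensorProduct.tmul_zero])
    (by
      rw [add_comm]
      apply qcomm_add_pow_eq_zero hq
      · simp only [Algebra.TensorProduct.tmul_mul_tmul, one_mul, mul_one, F_mul_Kinv hn hq,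
          TensorProduct.smul_tmul']
      · rw [Algebra.TensorProduct.tmul_pow, F_pow, TensorProduct.tmul_zero]
      · rw [Algebra.TensorProduct.tmul_pow, F_pow, TensorProduct.zero_tmul])
    (by
      simp only [add_mul, mul_add, Algebra.TensorProduct.tmul_mul_tmul, one_mul, mul_one,
        E_mul_K, TensorProduct.tmul_smul, TensorProduct.smul_tmul', smul_add])
    (by
      have hc : K n q ^ (n - 1) * K n q = K n q * K n q ^ (n - 1) := by
        rw [K_mul_Kinv hn, Kinv_mul_K hn]
      simp only [add_mul, mul_add, Algebra.TensorProduct.tmul_mul_tmul, one_mul, mul_one,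
        F_mul_K, TensorProduct.tmul_smul, TensorProduct.smul_tmul', smul_add, hc])
    (by
      have hq0 : q ≠ 0 := hq.ne_zero (by omega)
      have hEF : E n q * F n q = F n q * E n q + (q - q⁻¹)⁻¹ • (K n q - K n q ^ (n - 1)) := by
        rw [← E_F_comm]; abel
      simp only [add_mul, mul_add, Algebra.TensorProduct.tmul_mul_tmul,
        Algebra.TensorProduct.tmul_pow, one_mul, mul_one, hEF, E_mul_Kinv hn hq, F_mul_K,
        TensorProduct.tmul_smul, ← TensorProduct.smul_tmul', smul_sub, TensorProduct.add_tmul,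
        TensorProduct.tmul_add, TensorProduct.sub_tmul, TensorProduct.tmul_sub]
      abel)

/-- The counit: `ε(K) = 1`, `ε(E) = ε(F) = 0`. -/
noncomputable def counit (n : ℕ) (q : ℂ) (hn : 2 ≤ n) : Uq n q →ₐ[ℂ] ℂ :=
  lift 1 0 0 (one_pow _) (zero_pow (by omega)) (zero_pow (by omega)) (by simp) (by simp)
    (by simp)

theorem comul_gen (hn : 2 ≤ n) (hq : IsPrimitiveRoot q n) :
    comul hn hq (K n q) = K n q ⊗ₜ[ℂ] K n q ∧
    comul hn hq (E n q) = E n q ⊗ₜ[ℂ] K n q + 1 ⊗ₜ[ℂ] E n q ∧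
    comul hn hq (F n q) = F n q ⊗ₜ[ℂ] 1 + (K n q ^ (n - 1)) ⊗ₜ[ℂ] F n q :=
  lift_gen _ _ _ _ _ _ _ _ _

theorem counit_gen (hn : 2 ≤ n) :
    counit n q hn (K n q) = 1 ∧ counit n q hn (E n q) = 0 ∧ counit n q hn (F n q) = 0 :=
  lift_gen _ _ _ _ _ _ _ _ _

/-- The bialgebra structure of `u_q(sl₂)`. -/
noncomputable abbrev bialgebra (hn : 2 ≤ n) (hq : IsPrimitiveRoot q n) : Bialgebra ℂ (Uq n q) :=
  Bialgebra.ofAlgHom (comul hn hq) (counit n q hn)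
    (by
      obtain ⟨hK, hE, hF⟩ := comul_gen hn hq
      apply hom_ext <;>
        simp [hK, hE, hF, TensorProduct.add_tmul, TensorProduct.tmul_add,
          Algebra.TensorProduct.one_def, add_assoc])
    (by
      obtain ⟨hK, hE, hF⟩ := comul_gen hn hq
      obtain ⟨cK, cE, cF⟩ := counit_gen (q := q) hn
      apply hom_ext <;> simp [hK, hE, hF, cK, cE, cF])
    (by
      obtain ⟨hK, hE, hF⟩ := comul_gen hn hq
      obtain ⟨cK, cE, cF⟩ := counit_gen (q := q) hn
      apply hom_ext <;> simp [hK, hE, hF, cK, cE, cF])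

end Bialgebra

end Uq

end QuantumSL2

/-! Everything rests on the monomial basis. The monomials span because their span contains 1 and is
stable under left multiplication by `K`, `E`, `F`. They are independent because the left
multiplication formulas, read on a free space with basis indexed by `ZMod n × Fin n × Fin n`,
satisfy the defining relations (`actE_actF_comm`, `actE_pow`), and the resulting representation
sends monomials applied to the vector of 1 to basis vectors. The order of `q` enters through the
vanishing of `1 + q + ... + q^(n-1)`.

By the `q`-binomial theorem, Δ of a monomial is explicit (`comul_monomial`), with Gaussian
coefficients that are nonzero below degree `n`. Comparing single coordinates in the integral
equation kills every value except the one on `K F^(n-1) E^(n-1)`; conversely, the corresponding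
coordinate functional is an integral.

For the form, `x ↦ φ(K x)` is a trace (`trace_comm`): the twist moves the support of `φ` to `F^(n-1)
E^(n-1)`, with `K`-exponent 0, where the powers of `q` from commutation are 1 and the lower-order
terms of `[E, F]` are invisible. Symmetry follows at once. Multiplying `h` by complementary powers
of the generators extracts each coordinate of `h` (`trace_picks_coord`), whence nondegeneracy.

The scalar `(q - q⁻¹)⁻¹` is never assumed nonzero, so `n = 2` needs no separate treatment. -/

namespace QuantumSL2

/-! ### Commutation rules for powers -/

section Commutation

variable {A : Type*} [Ring A] [Algebra ℂ A]

/-- Moving `x` past a power of `y` when the commutator of `x` and `y` is a sum of two elements that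
commute with `y` up to scalars. -/
theorem mul_pow_succ_of_commutator {x y u w : A} {a b : ℂ} (hxy : x * y = y * x + (u + w))
    (hu : y * u = a • (u * y)) (hw : y * w = b • (w * y)) (m : ℕ) :
    x * y ^ (m + 1) = y ^ (m + 1) * x +
      ((∑ t ∈ Finset.range (m + 1), a ^ t) • u + (∑ t ∈ Finset.range (m + 1), b ^ t) • w) *
        y ^ m := by
  induction m with
  | zero => simpa using hxy
  | succ m ih =>
    rw [pow_succ' y (m + 1), ← mul_assoc, hxy, add_mul, mul_assoc y x, ih]
    simp only [Finset.sum_range_succ' _ (m + 1), pow_zero, pow_succ, ← Finset.sum_mul, mul_add,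
      add_mul, smul_mul_assoc, mul_smul_comm, add_smul, one_smul]
    simp only [← pow_succ, ← mul_assoc, hu, hw, smul_mul_assoc, smul_smul]
    simp only [mul_assoc, ← pow_succ']
    abel

theorem mul_eq_mul_add_of_commutator {x y u w : A} {c : ℂ} (h : x * y - y * x = c • (u - w)) :
    y * x = x * y + (-c • u + c • w) := by
  rw [neg_smul, neg_add_eq_sub, ← smul_sub, ← neg_sub u, smul_neg, ← h]
  abel

/-- A scalar commutation relation passes to powers of the second factor. -/
theorem mul_pow_of_qcomm {x y : A} {c : ℂ} (h : x * y = c • (y * x)) (m : ℕ) :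
    x * y ^ m = c ^ m • (y ^ m * x) :=
  qcomm_pow h m

/-- A scalar commutation relation passes to powers of both factors. -/
theorem pow_mul_pow_of_qcomm {x y : A} {c : ℂ} (h : x * y = c • (y * x)) (l m : ℕ) :
    x ^ l * y ^ m = c ^ (l * m) • (y ^ m * x ^ l) := by
  induction l with
  | zero => simp
  | succ l ih =>
    rw [pow_succ, mul_assoc, mul_pow_of_qcomm h, mul_smul_comm, ← mul_assoc, ih, smul_mul_assoc,
      smul_smul, mul_assoc, ← pow_add]
    congr 2
    ring

end Commutation

theorem geom_sum_eq_zero_of_isPrimitiveRoot {n : ℕ} (hn : 2 ≤ n) {q : ℂ}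
    (hq : IsPrimitiveRoot q n) : ∑ t ∈ Finset.range n, q ^ t = 0 :=
  hq.geom_sum_eq_zero (by omega)

/-! ### Multiplication of monomials by generators, and spanning -/

namespace Uq

variable {n : ℕ} {q : ℂ}

/-- The monomial `K^i F^j E^k`. -/
noncomputable def monomial (n : ℕ) (q : ℂ) (i j k : ℕ) : Uq n q :=
  K n q ^ i * F n q ^ j * E n q ^ k

theorem monomial_mod (i j k : ℕ) : monomial n q (i % n) j k = monomial n q i j k := by
  rw [monomial, monomial, ← pow_eq_pow_mod i (K_pow n q)]

theorem monomial_eq_of_modEq {i i' : ℕ} (h : i ≡ i' [MOD n]) (j k : ℕ) :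
    monomial n q i j k = monomial n q i' j k := by
  rw [← monomial_mod i, h, monomial_mod]

theorem monomial_eq_zero_of_le_left (i : ℕ) {j : ℕ} (h : n ≤ j) (k : ℕ) :
    monomial n q i j k = 0 := by
  rw [monomial, pow_eq_zero_of_le h (F_pow n q), mul_zero, zero_mul]

theorem monomial_eq_zero_of_le_right (i j : ℕ) {k : ℕ} (h : n ≤ k) :
    monomial n q i j k = 0 := by
  rw [monomial, pow_eq_zero_of_le h (E_pow n q), mul_zero]

theorem K_pow_mul_monomial (m i j k : ℕ) :
    K n q ^ m * monomial n q i j k = monomial n q (m + i) j k := by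
  rw [monomial, monomial, pow_add]
  simp only [mul_assoc]

theorem K_mul_monomial (i j k : ℕ) :
    K n q * monomial n q i j k = monomial n q (i + 1) j k := by
  simpa [add_comm] using K_pow_mul_monomial (n := n) (q := q) 1 i j k

theorem F_pow_mul_monomial (m i j k : ℕ) :
    F n q ^ m * monomial n q i j k = q⁻¹ ^ (m * i) • monomial n q i (m + j) k := by
  rw [monomial, monomial, ← mul_assoc, ← mul_assoc, pow_mul_pow_of_qcomm (F_mul_K n q),
    smul_mul_assoc, smul_mul_assoc, pow_add, mul_assoc (K n q ^ i)]

theorem F_mul_monomial (i j k : ℕ) :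
    F n q * monomial n q i j k = q⁻¹ ^ i • monomial n q i (j + 1) k := by
  simpa [add_comm] using F_pow_mul_monomial (n := n) (q := q) 1 i j k

theorem monomial_mul_E_pow (i j k m : ℕ) :
    monomial n q i j k * E n q ^ m = monomial n q i j (k + m) := by
  rw [monomial, monomial, mul_assoc, ← pow_add]

theorem monomial_mul_E (i j k : ℕ) :
    monomial n q i j k * E n q = monomial n q i j (k + 1) := by
  simpa using monomial_mul_E_pow (n := n) (q := q) i j k 1

theorem E_mul_F_pow_succ (hn : 2 ≤ n) (hq : IsPrimitiveRoot q n) (j : ℕ) :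
    E n q * F n q ^ (j + 1) = F n q ^ (j + 1) * E n q +
      ((∑ t ∈ Finset.range (j + 1), q⁻¹ ^ t) • ((q - q⁻¹)⁻¹ • K n q) +
        (∑ t ∈ Finset.range (j + 1), q ^ t) • (-(q - q⁻¹)⁻¹ • K n q ^ (n - 1))) *
        F n q ^ j := by
  apply mul_pow_succ_of_commutator
  · rw [neg_smul, ← sub_eq_add_neg, ← smul_sub, ← E_F_comm]
    abel
  · rw [mul_smul_comm, F_mul_K, smul_mul_assoc, smul_comm]
  · rw [mul_smul_comm, F_mul_Kinv hn hq, smul_mul_assoc, smul_comm]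

theorem F_mul_E_pow_succ (hn : 2 ≤ n) (hq : IsPrimitiveRoot q n) (k : ℕ) :
    F n q * E n q ^ (k + 1) = E n q ^ (k + 1) * F n q +
      ((∑ t ∈ Finset.range (k + 1), q ^ t) • (-(q - q⁻¹)⁻¹ • K n q) +
        (∑ t ∈ Finset.range (k + 1), q⁻¹ ^ t) • ((q - q⁻¹)⁻¹ • K n q ^ (n - 1))) *
        E n q ^ k := by
  apply mul_pow_succ_of_commutator
  · exact mul_eq_mul_add_of_commutator (E_F_comm n q)
  · rw [mul_smul_comm, E_mul_K, smul_mul_assoc, smul_comm]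
  · rw [mul_smul_comm, E_mul_Kinv hn hq, smul_mul_assoc, smul_comm]

theorem E_mul_monomial_zero (i k : ℕ) :
    E n q * monomial n q i 0 k = q ^ i • monomial n q i 0 (k + 1) := by
  rw [monomial, monomial, pow_zero, mul_one, ← mul_assoc,
    mul_pow_of_qcomm (E_mul_K n q), smul_mul_assoc, mul_assoc, pow_succ']

/-- Here `i + (n - 1)` stands for the exponent `i - 1`. Both corrections have lower degree in `F`.
-/
theorem E_mul_monomial_succ (hn : 2 ≤ n) (hq : IsPrimitiveRoot q n) (i j k : ℕ) :
    E n q * monomial n q i (j + 1) k = q ^ i • (monomial n q i (j + 1) (k + 1) +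
      ((∑ t ∈ Finset.range (j + 1), q⁻¹ ^ t) • ((q - q⁻¹)⁻¹ • monomial n q (i + 1) j k) +
        (∑ t ∈ Finset.range (j + 1), q ^ t) •
          (-(q - q⁻¹)⁻¹ • monomial n q (i + (n - 1)) j k))) := by
  simp only [monomial]
  rw [← mul_assoc, ← mul_assoc, mul_pow_of_qcomm (E_mul_K n q), smul_mul_assoc, smul_mul_assoc,
    mul_assoc (K n q ^ i), E_mul_F_pow_succ hn hq, pow_succ' (E n q) k]
  simp only [mul_add, add_mul, smul_mul_assoc, mul_smul_comm, pow_add, mul_assoc, pow_one]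

/-- `K^i F^j E^k F` differs from a multiple of `K^i F^(j+1) E^k` by monomials of lower degree
in `E`. -/
theorem monomial_succ_mul_F (hn : 2 ≤ n) (hq : IsPrimitiveRoot q n) (i j k : ℕ) :
    ∃ a b : ℂ, monomial n q i j (k + 1) * F n q = monomial n q i (j + 1) (k + 1) +
      (a • monomial n q (i + 1) j k + b • monomial n q (i + (n - 1)) j k) := by
  have h := F_mul_E_pow_succ hn hq k
  rw [← sub_eq_iff_eq_add] at h
  set α := ∑ t ∈ Finset.range (k + 1), q ^ t
  set β := ∑ t ∈ Finset.range (k + 1), q⁻¹ ^ t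
  -- The coefficients of `F_mul_E_pow_succ` change sign, and moving `K`, `K⁻¹` to the left of `F^j`
  -- contributes `q^(-j)`, `q^j`.
  refine ⟨(q - q⁻¹)⁻¹ * α * q⁻¹ ^ j, -(q - q⁻¹)⁻¹ * β * q ^ j, ?_⟩
  have h1 := pow_mul_pow_of_qcomm (F_mul_K n q) j 1
  have h2 := pow_mul_pow_of_qcomm (F_mul_Kinv hn hq) j 1
  simp only [pow_one, mul_one] at h1 h2
  simp only [monomial]
  rw [mul_assoc, ← h]
  simp only [mul_sub, mul_add, add_mul, smul_mul_assoc, mul_smul_comm, pow_add, pow_one,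
    mul_assoc, smul_smul, neg_smul, mul_neg, neg_mul]
  have e1 : F n q ^ j * (K n q * E n q ^ k) = q⁻¹ ^ j • (K n q * (F n q ^ j * E n q ^ k)) := by
    rw [← mul_assoc, h1, smul_mul_assoc, mul_assoc]
  have e2 : F n q ^ j * (K n q ^ (n - 1) * E n q ^ k) =
      q ^ j • (K n q ^ (n - 1) * (F n q ^ j * E n q ^ k)) := by
    rw [← mul_assoc, h2, smul_mul_assoc, mul_assoc]
  rw [e1, e2]
  simp only [mul_smul_comm, smul_smul]
  module

theorem monomial_mem_span (hn : 2 ≤ n) (i j k : ℕ) :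
    monomial n q i j k ∈ Submodule.span ℂ
      (Set.range fun p : Fin n × Fin n × Fin n => monomial n q p.1 p.2.1 p.2.2) := by
  rcases lt_or_ge j n with hj | hj
  · rcases lt_or_ge k n with hk | hk
    · refine Submodule.subset_span
        ⟨(⟨i % n, Nat.mod_lt _ (by omega)⟩, ⟨j, hj⟩, ⟨k, hk⟩), ?_⟩
      simp only [monomial_mod]
    · rw [monomial_eq_zero_of_le_right i j hk]
      exact Submodule.zero_mem _
  · rw [monomial_eq_zero_of_le_left i hj]
    exact Submodule.zero_mem _

/-- The algebra `u_q(sl₂)` is generated by `K`, `E` and `F`. -/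
theorem subalgebra_eq_top (S : Subalgebra ℂ (Uq n q)) (hK : K n q ∈ S) (hE : E n q ∈ S)
    (hF : F n q ∈ S) : S = ⊤ := by
  rw [eq_top_iff]
  intro x _
  obtain ⟨y, rfl⟩ : ∃ y, mk n q y = x := RingQuot.mkAlgHom_surjective ℂ (Relation n q) x
  induction y using FreeAlgebra.induction with
  | grade0 r => rw [AlgHom.commutes]; exact S.algebraMap_mem r
  | grade1 g => cases g; exacts [hK, hE, hF]
  | mul a b ha hb =>
    rw [map_mul]; exact S.mul_mem (ha trivial) (hb trivial)
  | add a b ha hb =>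
    rw [map_add]; exact S.add_mem (ha trivial) (hb trivial)

theorem span_monomial (hn : 2 ≤ n) (hq : IsPrimitiveRoot q n) :
    Submodule.span ℂ
      (Set.range fun p : Fin n × Fin n × Fin n => monomial n q p.1 p.2.1 p.2.2) = ⊤ := by
  set W := Submodule.span ℂ
      (Set.range fun p : Fin n × Fin n × Fin n => monomial n q p.1 p.2.1 p.2.2) with hW
  have hmem : ∀ i j k, monomial n q i j k ∈ W := monomial_mem_span hn
  have key : ∀ g : Uq n q, (∀ i j k, g * monomial n q i j k ∈ W) → ∀ w ∈ W, g * w ∈ W := by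
    intro g hg w hw
    induction hw using Submodule.span_induction with
    | mem x hx => obtain ⟨p, rfl⟩ := hx; exact hg _ _ _
    | zero => simp
    | add x y _ _ hx hy => rw [mul_add]; exact W.add_mem hx hy
    | smul c x _ hx => rw [mul_smul_comm]; exact W.smul_mem c hx
  -- The stabiliser of `W` is a subalgebra, so it suffices to test generators; then `W` is a left
  -- ideal containing 1.
  let S : Subalgebra ℂ (Uq n q) :=
    { carrier := {g | ∀ w ∈ W, g * w ∈ W}
      mul_mem' := fun {a b} ha hb w hw => by rw [mul_assoc]; exact ha _ (hb _ hw)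
      add_mem' := fun {a b} ha hb w hw => by rw [add_mul]; exact W.add_mem (ha _ hw) (hb _ hw)
      algebraMap_mem' := fun r w hw => by
        rw [← Algebra.smul_def]; exact W.smul_mem r hw }
  have hS : S = ⊤ := by
    refine subalgebra_eq_top S (key _ fun i j k => ?_) (key _ fun i j k => ?_)
      (key _ fun i j k => ?_)
    · rw [K_mul_monomial]; exact hmem _ _ _
    · rcases j with _ | j
      · rw [E_mul_monomial_zero]; exact W.smul_mem _ (hmem _ _ _)
      · rw [E_mul_monomial_succ hn hq]
        exact W.smul_mem _ (W.add_mem (hmem _ _ _) (W.add_mem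
          (W.smul_mem _ (W.smul_mem _ (hmem _ _ _))) (W.smul_mem _ (W.smul_mem _ (hmem _ _ _)))))
    · rw [F_mul_monomial]; exact W.smul_mem _ (hmem _ _ _)
  rw [eq_top_iff]
  intro x _
  have hx : x ∈ S := hS ▸ Algebra.mem_top
  have h1 := hx _ (hmem 0 0 0)
  simpa [monomial] using h1

/-! ### The regular representation and the monomial basis -/

section Representation

variable (n : ℕ)

/-- The space of formal combinations of the monomials `K^i F^j E^k`. -/
abbrev RegularModule : Type := (ZMod n × Fin n × Fin n) →₀ ℂ

variable {n}

/-- The formal monomial `K^i F^j E^k`, zero if `n ≤ j` or `n ≤ k`. -/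
noncomputable def formal (i : ZMod n) (j k : ℕ) : RegularModule n :=
  if h : j < n ∧ k < n then Finsupp.single (i, ⟨j, h.1⟩, ⟨k, h.2⟩) 1 else 0

theorem formal_of_lt (i : ZMod n) (j k : Fin n) :
    formal i (j : ℕ) (k : ℕ) = Finsupp.single (i, j, k) 1 := by
  simp [formal]

theorem formal_eq_zero_of_le_left (i : ZMod n) {j : ℕ} (h : n ≤ j) (k : ℕ) : formal i j k = 0 :=
  dif_neg fun h' => absurd h'.1 (not_lt.2 h)

theorem formal_eq_zero_of_le_right (i : ZMod n) (j : ℕ) {k : ℕ} (h : n ≤ k) : formal i j k = 0 :=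
  dif_neg fun h' => absurd h'.2 (not_lt.2 h)

theorem end_ext {f g : Module.End ℂ (RegularModule n)}
    (h : ∀ i j k, f (formal i j k) = g (formal i j k)) : f = g := by
  refine Finsupp.basisSingleOne.ext fun p => ?_
  have := h p.1 p.2.1 p.2.2
  rw [formal_of_lt] at this
  simpa using this

variable [NeZero n] {q : ℂ}

/-- The endomorphism with prescribed values on formal monomials. -/
noncomputable def ofFormal (f : ZMod n → ℕ → ℕ → RegularModule n) :
    Module.End ℂ (RegularModule n) :=
  (Finsupp.basisSingleOne (R := ℂ)).constr ℂ fun p => f p.1 p.2.1 p.2.2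

/-- Out of range the formal monomial is zero, so a prescription by natural exponents is consistent
only if it vanishes there. -/
theorem ofFormal_formal {f : ZMod n → ℕ → ℕ → RegularModule n}
    (hf : ∀ i j k, n ≤ j ∨ n ≤ k → f i j k = 0) (i : ZMod n) (j k : ℕ) :
    ofFormal f (formal i j k) = f i j k := by
  by_cases h : j < n ∧ k < n
  · have h1 := (Finsupp.basisSingleOne (R := ℂ)).constr_basis ℂ
      (fun p : ZMod n × Fin n × Fin n => f p.1 p.2.1 p.2.2) (i, ⟨j, h.1⟩, ⟨k, h.2⟩)
    rw [formal, dif_pos h]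
    simpa [ofFormal] using h1
  · rw [formal, dif_neg h, map_zero, hf i j k (by omega)]

/-- The character `i ↦ q^i` of `ℤ/n`. -/
noncomputable def weight (hq : IsPrimitiveRoot q n) : AddChar (ZMod n) ℂ :=
  AddChar.zmodChar n hq.pow_eq_one

theorem weight_one (hq : IsPrimitiveRoot q n) : weight hq 1 = q := by
  have := AddChar.zmodChar_apply' (n := n) hq.pow_eq_one 1
  simpa [weight] using this

theorem weight_add_one (hq : IsPrimitiveRoot q n) (i : ZMod n) :
    weight hq (i + 1) = weight hq i * q := by
  rw [AddChar.map_add_eq_mul, weight_one]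

theorem weight_ne_zero (hq : IsPrimitiveRoot q n) (i : ZMod n) : weight hq i ≠ 0 :=
  (AddChar.val_isUnit _ i).ne_zero

theorem weight_sub_one (hq : IsPrimitiveRoot q n) (i : ZMod n) :
    weight hq (i - 1) = weight hq i * q⁻¹ := by
  have h := weight_add_one hq (i - 1)
  rw [sub_add_cancel] at h
  rw [h, mul_inv_cancel_right₀ (hq.ne_zero (NeZero.ne n))]

/-- The action of `K`. -/
noncomputable def actK : Module.End ℂ (RegularModule n) :=
  ofFormal fun i j k => formal (i + 1) j k

/-- The action of `F`. -/
noncomputable def actF (hq : IsPrimitiveRoot q n) : Module.End ℂ (RegularModule n) :=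
  ofFormal fun i j k => (weight hq i)⁻¹ • formal i (j + 1) k

/-- The action of `E`. -/
noncomputable def actE (hq : IsPrimitiveRoot q n) : Module.End ℂ (RegularModule n) :=
  ofFormal fun i j k => if n ≤ j then 0 else weight hq i • (formal i j (k + 1) + (q - q⁻¹)⁻¹ •
    ((∑ t ∈ Finset.range j, q⁻¹ ^ t) • formal (i + 1) (j - 1) k -
      (∑ t ∈ Finset.range j, q ^ t) • formal (i - 1) (j - 1) k))

theorem actK_formal (i : ZMod n) (j k : ℕ) : actK (formal i j k) = formal (i + 1) j k := by
  refine ofFormal_formal (fun i j k h => ?_) i j k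
  rcases h with h | h
  · rw [formal_eq_zero_of_le_left _ h]
  · rw [formal_eq_zero_of_le_right _ _ h]

theorem actF_formal (hq : IsPrimitiveRoot q n) (i : ZMod n) (j k : ℕ) :
    actF hq (formal i j k) = (weight hq i)⁻¹ • formal i (j + 1) k := by
  refine ofFormal_formal (fun i j k h => ?_) i j k
  rcases h with h | h
  · rw [formal_eq_zero_of_le_left _ (by omega), smul_zero]
  · rw [formal_eq_zero_of_le_right _ _ h, smul_zero]

/-- The truncated `j - 1` is harmless at `j = 0`, where the sums in front of it are empty. -/
theorem actE_formal_of_lt (hq : IsPrimitiveRoot q n) (i : ZMod n) {j : ℕ} (hj : j < n) (k : ℕ) :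
    actE hq (formal i j k) = weight hq i • (formal i j (k + 1) + (q - q⁻¹)⁻¹ •
    ((∑ t ∈ Finset.range j, q⁻¹ ^ t) • formal (i + 1) (j - 1) k -
      (∑ t ∈ Finset.range j, q ^ t) • formal (i - 1) (j - 1) k)) := by
  refine (ofFormal_formal (fun i j k h => ?_) i j k).trans (if_neg (not_le.2 hj))
  rcases h with h | h
  · rw [if_pos h]
  · simp only [formal_eq_zero_of_le_right _ _ h, formal_eq_zero_of_le_right _ _ (h.trans k.le_succ),
      smul_zero, sub_zero, add_zero, ite_self]

theorem actE_formal_zero (hq : IsPrimitiveRoot q n) (i : ZMod n) (k : ℕ) :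
    actE hq (formal i 0 k) = weight hq i • formal i 0 (k + 1) := by
  rw [actE_formal_of_lt hq i (Nat.pos_of_ne_zero (NeZero.ne n))]
  simp

/-- The critical case is `j + 1 = n`: the left side is zero, while `formal (i ± 1) (n - 1) k` need
not be, but its coefficient is a full geometric sum over a primitive root. Hence the formula holds
with no bound on `j`. -/
theorem actE_formal_succ (hn : 2 ≤ n) (hq : IsPrimitiveRoot q n) (i : ZMod n) (j k : ℕ) :
    actE hq (formal i (j + 1) k) = weight hq i • (formal i (j + 1) (k + 1) + (q - q⁻¹)⁻¹ •
    ((∑ t ∈ Finset.range (j + 1), q⁻¹ ^ t) • formal (i + 1) j k -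
      (∑ t ∈ Finset.range (j + 1), q ^ t) • formal (i - 1) j k)) := by
  rcases lt_or_ge (j + 1) n with h | h
  · rw [actE_formal_of_lt hq i h, Nat.add_sub_cancel]
  · rw [formal_eq_zero_of_le_left _ h, formal_eq_zero_of_le_left _ h, map_zero]
    rcases h.eq_or_lt with h | h
    · rw [← h, geom_sum_eq_zero_of_isPrimitiveRoot hn hq,
        geom_sum_eq_zero_of_isPrimitiveRoot hn hq.inv]
      simp
    · rw [formal_eq_zero_of_le_left _ (by omega), formal_eq_zero_of_le_left _ (by omega)]
      simp

theorem actK_pow_formal (m : ℕ) (i : ZMod n) (j k : ℕ) :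
    (actK ^ m) (formal i j k) = formal (i + (m : ZMod n)) j k := by
  induction m with
  | zero => simp
  | succ m ih =>
    rw [pow_succ', Module.End.mul_apply, ih, actK_formal]
    push_cast
    rw [add_assoc]

theorem actF_pow_formal (hq : IsPrimitiveRoot q n) (m : ℕ) (i : ZMod n) (j k : ℕ) :
    (actF hq ^ m) (formal i j k) = (weight hq i)⁻¹ ^ m • formal i (j + m) k := by
  induction m with
  | zero => simp
  | succ m ih =>
    rw [pow_succ', Module.End.mul_apply, ih, map_smul, actF_formal, smul_smul, pow_succ, add_assoc]

theorem actE_pow_formal_zero (hq : IsPrimitiveRoot q n) (m : ℕ) (i : ZMod n) (k : ℕ) :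
    (actE hq ^ m) (formal i 0 k) = weight hq i ^ m • formal i 0 (k + m) := by
  induction m with
  | zero => simp
  | succ m ih =>
    rw [pow_succ', Module.End.mul_apply, ih, map_smul, actE_formal_zero, smul_smul, pow_succ,
      add_assoc]

theorem actK_pow : (actK : Module.End ℂ (RegularModule n)) ^ n = 1 :=
  end_ext fun i j k => by simp [actK_pow_formal]

theorem actF_pow (hq : IsPrimitiveRoot q n) : actF hq ^ n = 0 :=
  end_ext fun i j k => by
    rw [actF_pow_formal, formal_eq_zero_of_le_left _ (by omega), smul_zero, LinearMap.zero_apply]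

theorem actE_mul_actK (hn : 2 ≤ n) (hq : IsPrimitiveRoot q n) :
    actE hq * actK = q • (actK * actE hq) := by
  refine end_ext fun i j k => ?_
  rcases j with _ | j
  · simp only [Module.End.mul_apply, LinearMap.smul_apply, actK_formal, actE_formal_zero, map_smul,
      weight_add_one, smul_smul, mul_comm]
  · simp only [Module.End.mul_apply, LinearMap.smul_apply, actK_formal, actE_formal_succ hn,
      map_smul, weight_add_one, smul_smul, mul_comm, map_add, map_sub, sub_add_cancel,
      add_sub_cancel_right]

theorem actF_mul_actK (hq : IsPrimitiveRoot q n) :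
    actF hq * actK = q⁻¹ • (actK * actF hq) :=
  end_ext fun i j k => by
    simp only [Module.End.mul_apply, LinearMap.smul_apply, actK_formal, actF_formal, map_smul,
      weight_add_one, smul_smul, mul_inv_rev]

theorem actK_pow_pred_formal (i : ZMod n) (j k : ℕ) :
    (actK ^ (n - 1)) (formal i j k) = formal (i - 1) j k := by
  rw [actK_pow_formal, Nat.cast_pred (Nat.pos_of_ne_zero (NeZero.ne n)), ZMod.natCast_self,
    zero_sub, ← sub_eq_add_neg]

theorem actE_actF_comm (hn : 2 ≤ n) (hq : IsPrimitiveRoot q n) :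
    actE hq * actF hq - actF hq * actE hq = (q - q⁻¹)⁻¹ • (actK - actK ^ (n - 1)) := by
  have hq0 : q ≠ 0 := hq.ne_zero (NeZero.ne n)
  refine end_ext fun i j k => ?_
  have hw := weight_ne_zero hq i
  simp only [LinearMap.sub_apply, Module.End.mul_apply, LinearMap.smul_apply, actK_pow_pred_formal,
    actK_formal, actF_formal, map_smul, actE_formal_succ hn, smul_smul]
  rw [inv_mul_cancel₀ hw, one_smul]
  rcases j with _ | j
  · rw [actE_formal_zero, map_smul, actF_formal, smul_smul, mul_inv_cancel₀ hw]
    simp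
  · rw [actE_formal_succ hn]
    simp only [map_smul, map_add, map_sub, actF_formal, weight_add_one, weight_sub_one]
    -- The shifts `i ± 1` in the weights multiply the shorter sums by `q⁻¹` and `q`; peeling off one
    -- term leaves exactly 1, the coefficient in `K - K⁻¹`.
    rw [geom_sum_succ (n := j + 1), geom_sum_succ (n := j + 1)]
    generalize ∑ t ∈ Finset.range (j + 1), q ^ t = α
    generalize ∑ t ∈ Finset.range (j + 1), q⁻¹ ^ t = β
    match_scalars <;> field_simp <;> ring

/-- The corrections in commuting `F` past `E^n` carry full geometric sums, so `E^n` commutes with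
`F`. It kills the vectors with `j = 0`, and `F` generates the rest from these. -/
theorem actE_pow (hn : 2 ≤ n) (hq : IsPrimitiveRoot q n) : actE hq ^ n = 0 := by
  have hn1 : n = (n - 1) + 1 := by omega
  have hq0 : q ≠ 0 := hq.ne_zero (NeZero.ne n)
  have hEKi : actE hq * actK ^ (n - 1) = q⁻¹ • (actK ^ (n - 1) * actE hq) := by
    have h := mul_pow_of_qcomm (A := Module.End ℂ (RegularModule n)) (actE_mul_actK hn hq) (n - 1)
    have hqi : q ^ (n - 1) = q⁻¹ := by
      exact eq_inv_of_mul_eq_one_left (by rw [← pow_succ, ← hn1, hq.pow_eq_one])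
    rwa [hqi] at h
  have hcomm : actF hq * actE hq = actE hq * actF hq +
      (-(q - q⁻¹)⁻¹ • actK + (q - q⁻¹)⁻¹ • actK ^ (n - 1)) :=
    mul_eq_mul_add_of_commutator (A := Module.End ℂ (RegularModule n)) (actE_actF_comm hn hq)
  have hFE : actF hq * actE hq ^ n = actE hq ^ n * actF hq := by
    have h := mul_pow_succ_of_commutator (A := Module.End ℂ (RegularModule n)) (x := actF hq) (y := actE hq)
      (u := -(q - q⁻¹)⁻¹ • actK) (w := (q - q⁻¹)⁻¹ • actK ^ (n - 1)) (a := q) (b := q⁻¹)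
      hcomm
      (by rw [mul_smul_comm, actE_mul_actK hn, smul_mul_assoc, smul_comm])
      (by rw [mul_smul_comm, hEKi, smul_mul_assoc, smul_comm]) (n - 1)
    rw [← hn1, geom_sum_eq_zero_of_isPrimitiveRoot hn hq,
        geom_sum_eq_zero_of_isPrimitiveRoot hn hq.inv] at h
    simpa using h
  refine end_ext fun i j k => ?_
  rw [LinearMap.zero_apply]
  induction j with
  | zero =>
    rw [actE_pow_formal_zero, formal_eq_zero_of_le_right _ _ (by omega), smul_zero]
  | succ j ih =>
    have h := actF_formal hq i j k
    rw [eq_inv_smul_iff₀ (weight_ne_zero hq i)] at h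
    rw [← h, map_smul, ← Module.End.mul_apply, ← hFE, Module.End.mul_apply, ih, map_zero,
      smul_zero]

/-- The regular representation of `u_q(sl₂)` in the basis of monomials. -/
noncomputable def regularRep (hn : 2 ≤ n) (hq : IsPrimitiveRoot q n) :
    Uq n q →ₐ[ℂ] Module.End ℂ (RegularModule n) :=
  lift actK (actE hq) (actF hq) actK_pow (actE_pow hn hq) (actF_pow hq) (actE_mul_actK hn hq)
    (actF_mul_actK hq) (actE_actF_comm hn hq)

/-- The vector `formal 0 0 0` plays the role of 1. `E` acts first, where `j = 0` and no correction
occurs, and the weights of `E` and `F` at exponent 0 are 1. -/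
theorem regularRep_monomial (hn : 2 ≤ n) (hq : IsPrimitiveRoot q n) (i j k : ℕ) :
    regularRep hn hq (monomial n q i j k) (formal 0 0 0) = formal i j k := by
  obtain ⟨hK, hE, hF⟩ := lift_gen (n := n) (q := q) actK (actE hq) (actF hq) actK_pow
    (actE_pow hn hq) (actF_pow hq) (actE_mul_actK hn hq) (actF_mul_actK hq) (actE_actF_comm hn hq)
  rw [monomial, map_mul, map_mul, map_pow, map_pow, map_pow]
  unfold regularRep
  rw [hK, hE, hF, Module.End.mul_apply, Module.End.mul_apply, actE_pow_formal_zero, map_smul,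
    actF_pow_formal, AddChar.map_zero_eq_one]
  simp [actK_pow_formal]

end Representation

variable {n : ℕ} {q : ℂ}

theorem linearIndependent_monomial (hn : 2 ≤ n) (hq : IsPrimitiveRoot q n) :
    LinearIndependent ℂ
      fun p : Fin n × Fin n × Fin n => monomial n q p.1 p.2.1 p.2.2 := by
  have : NeZero n := ⟨by omega⟩
  refine LinearIndependent.of_comp
    ((LinearMap.applyₗ (formal 0 0 0)).comp (regularRep hn hq).toLinearMap) ?_
  have hinj : Function.Injective
      fun p : Fin n × Fin n × Fin n => (((p.1 : ℕ) : ZMod n), p.2.1, p.2.2) := by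
    rintro ⟨i, j, k⟩ ⟨i', j', k'⟩ h
    simp only [Prod.mk.injEq] at h
    have hi := congrArg ZMod.val h.1
    rw [ZMod.val_natCast_of_lt i.2, ZMod.val_natCast_of_lt i'.2] at hi
    rw [Fin.ext hi, h.2.1, h.2.2]
  convert (Finsupp.linearIndependent_single_one ℂ (ZMod n × Fin n × Fin n)).comp _ hinj using 1
  funext p
  simp only [Function.comp_apply, LinearMap.comp_apply, AlgHom.toLinearMap_apply,
    LinearMap.applyₗ_apply_apply, regularRep_monomial, formal_of_lt]

/-- The basis of monomials `K^i F^j E^k`. -/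
noncomputable def monomialBasis (hn : 2 ≤ n) (hq : IsPrimitiveRoot q n) :
    Module.Basis (Fin n × Fin n × Fin n) ℂ (Uq n q) :=
  Module.Basis.mk (linearIndependent_monomial hn hq) (span_monomial hn hq).ge

theorem monomialBasis_apply (hn : 2 ≤ n) (hq : IsPrimitiveRoot q n) (p : Fin n × Fin n × Fin n) :
    monomialBasis hn hq p = monomial n q p.1 p.2.1 p.2.2 :=
  Module.Basis.mk_apply _ _ _

/-- Allowing arbitrary natural exponents spares later computations the reduction of exponents to
their ranges. -/
theorem monomialBasis_coord_monomial (hn : 2 ≤ n) (hq : IsPrimitiveRoot q n)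
    (p : Fin n × Fin n × Fin n) (i j k : ℕ) :
    (monomialBasis hn hq).coord p (monomial n q i j k) =
      if i ≡ p.1 [MOD n] ∧ j = p.2.1 ∧ k = p.2.2 then 1 else 0 := by
  rcases lt_or_ge j n with hj | hj
  swap
  · rw [monomial_eq_zero_of_le_left i hj, map_zero, if_neg (by omega)]
  rcases lt_or_ge k n with hk | hk
  swap
  · rw [monomial_eq_zero_of_le_right i j hk, map_zero, if_neg (by omega)]
  have hi : i % n < n := Nat.mod_lt _ (by omega)
  have h := monomialBasis_apply hn hq (⟨i % n, hi⟩, ⟨j, hj⟩, ⟨k, hk⟩)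
  rw [monomial_mod] at h
  rw [← h, Module.Basis.coord_apply, Module.Basis.repr_self, Finsupp.single_apply]
  congr 1
  simp only [Prod.ext_iff, Fin.ext_iff, Nat.ModEq, Nat.mod_eq_of_lt p.1.2]

end Uq
end QuantumSL2

/-! ### Gaussian binomials at a root of unity -/

namespace QuantumSL2

/-- The factors `1 - q^t` with `0 < t < n` are nonzero. This is what allows the integral equation to
be solved for values of `φ`. -/
theorem qChoose_ne_zero {n : ℕ} {q : ℂ} (hq : IsPrimitiveRoot q n) {m k : ℕ} (hm : m < n)
    (hk : k ≤ m) : qChoose q m k ≠ 0 := by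
  have h := qChoose_mul_qFact q m k (m - k) (by omega)
  have hm0 : qFact q m ≠ 0 := by
    refine Finset.prod_ne_zero_iff.2 fun t ht => ?_
    have ht' := Finset.mem_range.1 ht
    exact sub_ne_zero.2 (hq.pow_ne_one_of_pos_of_lt (by omega) (by omega)).symm
  intro h0
  rw [h0, zero_mul] at h
  exact hm0 h.symm

theorem qChoose_zero_right (q : ℂ) (m : ℕ) : qChoose q m 0 = 1 := by
  cases m <;> rfl

theorem qChoose_self (q : ℂ) (m : ℕ) : qChoose q m m = 1 := by
  induction m with
  | zero => rfl
  | succ m ih => rw [qChoose, ih, qChoose_eq_zero q m (m + 1) (by omega), mul_zero, add_zero]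

namespace Uq

variable {n : ℕ} {q : ℂ}

/-! ### Integrals -/

/-- The two summands of ΔF, and of ΔE, `q`-commute, so the `q`-binomial theorem applies to each
power. The factor `q^(-st)` comes from moving `K^t` past `F^s` in the second tensor factor. -/
theorem comul_monomial (hn : 2 ≤ n) (hq : IsPrimitiveRoot q n) (i j k : ℕ) :
    comul hn hq (monomial n q i j k) =
      ∑ s ∈ Finset.range (j + 1), ∑ t ∈ Finset.range (k + 1),
        (qChoose q j s * qChoose q k t * q⁻¹ ^ (s * t)) •
          (monomial n q (i + (n - 1) * s) (j - s) t ⊗ₜ[ℂ] monomial n q (i + t) s (k - t)) := by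
  obtain ⟨hK, hE, hF⟩ := comul_gen hn hq
  rw [monomial, map_mul, map_mul, map_pow, map_pow, map_pow, hK, hE, hF, add_comm (F n q ⊗ₜ[ℂ] 1),
    qcomm_add_pow (q := q) (x := (K n q ^ (n - 1)) ⊗ₜ[ℂ] F n q) (y := F n q ⊗ₜ[ℂ] 1)
      (by simp only [Algebra.TensorProduct.tmul_mul_tmul, one_mul, mul_one, F_mul_Kinv hn hq,
          TensorProduct.smul_tmul']),
    qcomm_add_pow (q := q) (x := E n q ⊗ₜ[ℂ] K n q) (y := 1 ⊗ₜ[ℂ] E n q)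
      (by simp only [Algebra.TensorProduct.tmul_mul_tmul, one_mul, mul_one, E_mul_K,
          TensorProduct.tmul_smul]), mul_assoc, Finset.sum_mul_sum, Finset.mul_sum]
  refine Finset.sum_congr rfl fun s _ => ?_
  rw [Finset.mul_sum]
  refine Finset.sum_congr rfl fun t _ => ?_
  have h := pow_mul_pow_of_qcomm (F_mul_K n q) s t
  have e : F n q ^ s * (K n q ^ t * E n q ^ (k - t)) =
      q⁻¹ ^ (s * t) • (K n q ^ t * (F n q ^ s * E n q ^ (k - t))) := by
    rw [← mul_assoc, h, smul_mul_assoc, mul_assoc]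
  simp only [monomial, Algebra.TensorProduct.tmul_pow, one_pow, Algebra.TensorProduct.tmul_mul_tmul,
    mul_one, smul_mul_assoc, mul_smul_comm, smul_smul, pow_add, pow_mul, mul_assoc, e,
    TensorProduct.tmul_smul]
  congr 1
  rw [← pow_mul]
  ring

/-- The map `(φ ⊗ id) ∘ Δ`. -/
noncomputable def contractComul (hn : 2 ≤ n) (hq : IsPrimitiveRoot q n) (φ : Uq n q →ₗ[ℂ] ℂ) :
    Uq n q →ₗ[ℂ] Uq n q :=
  (TensorProduct.lid ℂ (Uq n q)).toLinearMap ∘ₗ φ.rTensor (Uq n q) ∘ₗ (comul hn hq).toLinearMap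

theorem isHopfIntegral_iff (hn : 2 ≤ n) (hq : IsPrimitiveRoot q n) (φ : Uq n q →ₗ[ℂ] ℂ) :
    letI := bialgebra hn hq
    IsHopfIntegral φ ↔ ∀ x, contractComul hn hq φ x = φ x • (1 : Uq n q) :=
  Iff.rfl

theorem contractComul_monomial (hn : 2 ≤ n) (hq : IsPrimitiveRoot q n) (φ : Uq n q →ₗ[ℂ] ℂ)
    (i j k : ℕ) :
    contractComul hn hq φ (monomial n q i j k) =
      ∑ s ∈ Finset.range (j + 1), ∑ t ∈ Finset.range (k + 1),
        (qChoose q j s * qChoose q k t * q⁻¹ ^ (s * t) *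
          φ (monomial n q (i + (n - 1) * s) (j - s) t)) • monomial n q (i + t) s (k - t) := by
  simp only [contractComul, LinearMap.comp_apply, AlgHom.toLinearMap_apply, comul_monomial,
    map_sum, map_smul, LinearMap.rTensor_tmul, LinearEquiv.coe_coe, TensorProduct.lid_tmul,
    smul_smul]

/-- Applying to `(φ ⊗ id) Δ(K^i F^j E^k)` a functional that only sees one pair of exponents. -/
theorem apply_contractComul_monomial (hn : 2 ≤ n) (hq : IsPrimitiveRoot q n)
    (φ g : Uq n q →ₗ[ℂ] ℂ) {i j k s₀ t₀ : ℕ} (hs : s₀ ≤ j) (ht : t₀ ≤ k)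
    (hg : ∀ i s t, s ≠ s₀ ∨ t ≠ k - t₀ → g (monomial n q i s t) = 0) :
    g (contractComul hn hq φ (monomial n q i j k)) =
      (qChoose q j s₀ * qChoose q k t₀ * q⁻¹ ^ (s₀ * t₀) *
        φ (monomial n q (i + (n - 1) * s₀) (j - s₀) t₀)) * g (monomial n q (i + t₀) s₀ (k - t₀)) := by
  rw [contractComul_monomial, map_sum, Finset.sum_eq_single_of_mem s₀
    (Finset.mem_range.2 (by omega)), map_sum, Finset.sum_eq_single_of_mem t₀
    (Finset.mem_range.2 (by omega)), map_smul, smul_eq_mul]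
  · intro t ht' h
    have := Finset.mem_range.1 ht'
    rw [map_smul, hg _ _ _ (Or.inr (by omega)), smul_zero]
  · intro s _ h
    rw [map_sum]
    exact Finset.sum_eq_zero fun t _ => by rw [map_smul, hg _ _ _ (Or.inl h), smul_zero]

theorem monomial_zero : monomial n q 0 0 0 = 1 := by
  simp [monomial]

section

variable (hn : 2 ≤ n) (hq : IsPrimitiveRoot q n) {φ : Uq n q →ₗ[ℂ] ℂ}

include hn hq

/-- The coordinate functionals of the monomial basis, evaluated on all monomials. -/
theorem exists_functional (i j k : ℕ) (hj : j < n) (hk : k < n) :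
    ∃ g : Uq n q →ₗ[ℂ] ℂ, ∀ i' j' k', g (monomial n q i' j' k') =
      if i' ≡ i [MOD n] ∧ j' = j ∧ k' = k then 1 else 0 := by
  refine ⟨(monomialBasis hn hq).coord (⟨i % n, Nat.mod_lt _ (by omega)⟩, ⟨j, hj⟩, ⟨k, hk⟩),
    fun i' j' k' => ?_⟩
  rw [monomialBasis_coord_monomial]
  exact if_congr (and_congr_left' (by simp only [Nat.ModEq, Nat.mod_mod])) rfl rfl

/-- In the integral equation for `K^(i+1) F^(j+1) E^k`, the coefficient of `K^(i+1+k) F` is a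
nonzero multiple of `φ(K^i F^j E^k)`, while a multiple of 1 has no such term. The extra `K` cancels
the `K⁻¹` of ΔF. -/
theorem integral_eq_zero_of_lt_left
    (hφ : ∀ x, contractComul hn hq φ x = φ x • (1 : Uq n q)) (i : ℕ) {j k : ℕ} (hj : j + 1 < n)
    (hk : k < n) : φ (monomial n q i j k) = 0 := by
  obtain ⟨g, hg⟩ := exists_functional hn hq (i + 1 + k) 1 0 (by omega) (by omega)
  have h := apply_contractComul_monomial hn hq φ g (i := i + 1) (j := j + 1) (k := k) (s₀ := 1)
    (t₀ := k) (by omega) le_rfl (fun i s t h => by rw [hg, if_neg (by omega)])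
  rw [hφ, map_smul, ← monomial_zero, hg, hg, if_neg (by omega), if_pos ⟨rfl, rfl, by omega⟩,
    smul_zero, mul_one, Nat.add_sub_cancel,
    monomial_eq_of_modEq (i := i + 1 + (n - 1) * 1) (i' := i)
      (by rw [show i + 1 + (n - 1) * 1 = i + n by omega]; exact Nat.add_modEq_right)] at h
  have h0 : q⁻¹ ≠ 0 := inv_ne_zero (hq.ne_zero (by omega))
  exact (mul_eq_zero.1 h.symm).resolve_left (mul_ne_zero (mul_ne_zero
    (qChoose_ne_zero hq hj (by omega)) (qChoose_ne_zero hq hk le_rfl)) (pow_ne_zero _ h0))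

/-- Same comparison for `K^i F^j E^(k+1)`, at the coefficient of `K^(i+k) E`. -/
theorem integral_eq_zero_of_lt_right
    (hφ : ∀ x, contractComul hn hq φ x = φ x • (1 : Uq n q)) (i : ℕ) {j k : ℕ} (hk : k + 1 < n) :
    φ (monomial n q i j k) = 0 := by
  obtain ⟨g, hg⟩ := exists_functional hn hq (i + k) 0 1 (by omega) (by omega)
  have h := apply_contractComul_monomial hn hq φ g (i := i) (j := j) (k := k + 1) (s₀ := 0)
    (t₀ := k) (by omega) (by omega) (fun i s t h => by rw [hg, if_neg (by omega)])
  rw [hφ, map_smul, ← monomial_zero, hg, hg, if_neg (by omega), if_pos ⟨rfl, rfl, by omega⟩,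
    smul_zero, mul_one, zero_mul, pow_zero, mul_one, mul_zero, add_zero, Nat.sub_zero,
    qChoose_zero_right, one_mul] at h
  exact (mul_eq_zero.1 h.symm).resolve_left (qChoose_ne_zero hq hk (by omega))

/-- The term of the contraction free of `E` and `F` is a multiple of `K^(i-1)`, so its coefficient
at 1 is zero, whereas the equation requires `φ` of the monomial. -/
theorem integral_top_eq_zero
    (hφ : ∀ x, contractComul hn hq φ x = φ x • (1 : Uq n q)) {i : ℕ} (hi : ¬ i ≡ 1 [MOD n]) :
    φ (monomial n q i (n - 1) (n - 1)) = 0 := by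
  obtain ⟨g, hg⟩ := exists_functional hn hq 0 0 0 (by omega) (by omega)
  have h := apply_contractComul_monomial hn hq φ g (i := i) (j := n - 1) (k := n - 1) (s₀ := 0)
    (t₀ := n - 1) (by omega) le_rfl (fun i s t h => by rw [hg, if_neg (by omega)])
  have hi' : ¬ i + (n - 1) ≡ 0 [MOD n] := by
    intro h0
    refine hi ((Nat.ModEq.add_right_cancel' (n - 1) (h0.trans ?_)))
    rw [Nat.add_sub_cancel' (by omega)]
    simp [Nat.ModEq]
  rw [hφ, map_smul, ← monomial_zero, hg, hg, if_pos ⟨rfl, rfl, rfl⟩,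
    if_neg (fun h' => hi' h'.1), mul_zero, smul_eq_mul, mul_one] at h
  exact h

/-- The values of a normalized integral on monomials. -/
theorem integral_monomial (hφ : ∀ x, contractComul hn hq φ x = φ x • (1 : Uq n q))
    (h1 : φ (monomial n q 1 (n - 1) (n - 1)) = 1) (i j k : ℕ) :
    φ (monomial n q i j k) = if i ≡ 1 [MOD n] ∧ j = n - 1 ∧ k = n - 1 then 1 else 0 := by
  rcases lt_or_ge j n with hj | hj
  swap
  · rw [monomial_eq_zero_of_le_left i hj, map_zero, if_neg (by omega)]
  rcases lt_or_ge k n with hk | hk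
  swap
  · rw [monomial_eq_zero_of_le_right i j hk, map_zero, if_neg (by omega)]
  rcases lt_or_ge (k + 1) n with hk' | hk'
  · rw [integral_eq_zero_of_lt_right hn hq hφ i hk', if_neg (by omega)]
  rcases lt_or_ge (j + 1) n with hj' | hj'
  · rw [integral_eq_zero_of_lt_left hn hq hφ i hj' hk, if_neg (by omega)]
  obtain rfl : j = n - 1 := by omega
  obtain rfl : k = n - 1 := by omega
  by_cases hi : i ≡ 1 [MOD n]
  · rw [monomial_eq_of_modEq hi, h1, if_pos ⟨hi, rfl, rfl⟩]
  · rw [integral_top_eq_zero hn hq hφ hi, if_neg (fun h => hi h.1)]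

/-- First tensor factors never have larger exponents of `F` or `E` than the monomial itself, so only
the top monomials contribute. There one term survives, with second factor `K^(i-1)`, equal to 1 when
`i ≡ 1`. -/
theorem contractComul_eq_of_apply_monomial
    (hφ : ∀ i j k, φ (monomial n q i j k) =
      if i ≡ 1 [MOD n] ∧ j = n - 1 ∧ k = n - 1 then 1 else 0) (x : Uq n q) :
    contractComul hn hq φ x = φ x • (1 : Uq n q) := by
  suffices h : contractComul hn hq φ = φ.smulRight (1 : Uq n q) by
    rw [h, LinearMap.smulRight_apply]
  refine (monomialBasis hn hq).ext fun p => ?_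
  obtain ⟨⟨i, hi⟩, ⟨j, hj⟩, ⟨k, hk⟩⟩ := p
  rw [monomialBasis_apply, LinearMap.smulRight_apply, contractComul_monomial]
  simp only
  by_cases hjk : j = n - 1 ∧ k = n - 1
  · obtain ⟨rfl, rfl⟩ := hjk
    rw [Finset.sum_eq_single_of_mem 0 (Finset.mem_range.2 (by omega)),
      Finset.sum_eq_single_of_mem (n - 1) (Finset.mem_range.2 (by omega))]
    · rw [qChoose_zero_right, qChoose_self, zero_mul, pow_zero, mul_zero, Nat.sub_zero, add_zero,
        Nat.sub_self, one_mul, one_mul, one_mul]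
      by_cases h1 : i ≡ 1 [MOD n]
      · rw [← monomial_zero, monomial_eq_of_modEq (i := i + (n - 1)) (i' := 0)]
        refine (h1.add_right (n - 1)).trans ?_
        rw [Nat.add_sub_cancel' (by omega)]
        simp [Nat.ModEq]
      · rw [hφ, if_neg (fun h => h1 h.1), zero_smul, zero_smul]
    · intro t _ ht
      rw [hφ, if_neg (by omega), mul_zero, zero_smul]
    · intro s hs hs0
      have := Finset.mem_range.1 hs
      refine Finset.sum_eq_zero fun t _ => ?_
      rw [hφ, if_neg (by omega), mul_zero, zero_smul]
  · rw [hφ, if_neg (by omega), zero_smul]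
    refine Finset.sum_eq_zero fun s hs => Finset.sum_eq_zero fun t ht => ?_
    have := Finset.mem_range.1 hs
    have := Finset.mem_range.1 ht
    rw [hφ, if_neg (by omega), mul_zero, zero_smul]

/-! ### The trace form -/

theorem trace_comm
    (hφ : ∀ i j k, φ (monomial n q i j k) =
      if i ≡ 1 [MOD n] ∧ j = n - 1 ∧ k = n - 1 then 1 else 0) (x y : Uq n q) :
    φ (K n q * (x * y)) = φ (K n q * (y * x)) := by
  have key : ∀ x : Uq n q, (∀ i j k, j < n → k < n → φ (K n q * (x * monomial n q i j k)) =
      φ (K n q * (monomial n q i j k * x))) → ∀ y, φ (K n q * (x * y)) = φ (K n q * (y * x)) := by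
    intro x hx y
    have : φ ∘ₗ LinearMap.mulLeft ℂ (K n q) ∘ₗ LinearMap.mulLeft ℂ x =
        φ ∘ₗ LinearMap.mulLeft ℂ (K n q) ∘ₗ LinearMap.mulRight ℂ x :=
      (monomialBasis hn hq).ext fun p => by
        rw [monomialBasis_apply]
        exact hx _ _ _ p.2.1.2 p.2.2.2
    exact LinearMap.congr_fun this y
  -- The elements that may be cycled past every `y` form a subalgebra, so only the generators need
  -- checking, against basis monomials.
  let S : Subalgebra ℂ (Uq n q) :=
    { carrier := {x | ∀ y, φ (K n q * (x * y)) = φ (K n q * (y * x))}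
      mul_mem' := fun {a b} ha hb y => by
        rw [mul_assoc, ha, mul_assoc, hb, mul_assoc]
      add_mem' := fun {a b} ha hb y => by
        rw [add_mul, mul_add, map_add, ha, hb, mul_add, mul_add, map_add]
      algebraMap_mem' := fun r y => by rw [Algebra.commutes r y] }
  suffices hS : S = ⊤ by
    have hx : x ∈ S := hS ▸ Algebra.mem_top
    exact hx y
  have hq0 : q ≠ 0 := hq.ne_zero (by omega)
  -- After the twist by `K`, only exponents `i ≡ 0` contribute; there the factor `q^i` from moving
  -- `E` past `K^i` is 1, as is its inverse for `F`.
  have hqi : ∀ i, i + 1 ≡ 1 [MOD n] → q ^ i = 1 := fun i h =>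
    (hq.pow_eq_one_iff_dvd i).2 (Nat.modEq_zero_iff_dvd.1 (Nat.ModEq.add_right_cancel' 1 h))
  refine subalgebra_eq_top S (key _ fun i j k hj hk => ?_) (key _ fun i j k hj hk => ?_)
    (key _ fun i j k hj hk => ?_)
  · have h1 : monomial n q i j k * K n q =
        (q ^ k * q⁻¹ ^ j) • monomial n q (i + 1) j k := by
      have h2 := pow_mul_pow_of_qcomm (E_mul_K n q) k 1
      have h3 := pow_mul_pow_of_qcomm (F_mul_K n q) j 1
      simp only [pow_one, mul_one] at h2 h3
      rw [monomial, monomial, mul_assoc, h2, mul_smul_comm, ← mul_assoc, mul_assoc (K n q ^ i), h3,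
        mul_smul_comm, smul_mul_assoc, smul_smul, ← mul_assoc, ← pow_succ]
    rw [h1, mul_smul_comm, map_smul, K_mul_monomial, K_mul_monomial, hφ, smul_eq_mul]
    split_ifs with h
    · rw [h.2.1, h.2.2, ← mul_pow, mul_inv_cancel₀ hq0, one_pow, mul_one]
    · rw [mul_zero]
  · rw [monomial_mul_E, K_mul_monomial, hφ]
    rcases j with _ | j
    · rw [E_mul_monomial_zero, mul_smul_comm, K_mul_monomial, map_smul, hφ, if_neg (by omega),
        smul_zero]
    · simp only [E_mul_monomial_succ hn hq, mul_smul_comm, mul_add, K_mul_monomial, map_smul,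
        map_add, hφ]
      -- The corrections contain `F^j` with `j + 1 < n`, below the top degree, so `φ` does not see
      -- them.
      rw [if_neg (by omega : ¬(_ ∧ j = n - 1 ∧ _)), if_neg (by omega : ¬(_ ∧ j = n - 1 ∧ _))]
      split_ifs with h
      · simp [hqi i h.1]
      · simp
  · rw [F_mul_monomial, mul_smul_comm, K_mul_monomial, map_smul, hφ]
    rcases k with _ | k
    · rw [if_neg (by omega), monomial, pow_zero, mul_one, mul_assoc, ← pow_succ]
      have h := hφ (i + 1) (j + 1) 0
      rw [if_neg (by omega), ← K_mul_monomial, monomial, pow_zero, mul_one] at h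
      rw [h, smul_zero]
    · obtain ⟨a, b, h⟩ := monomial_succ_mul_F hn hq i j k
      simp only [h, mul_smul_comm, mul_add, K_mul_monomial, map_smul, map_add, hφ]
      -- Likewise the corrections contain `E^k` with `k + 1 < n`; their coefficients `a`, `b` are
      -- irrelevant.
      rw [if_neg (by omega : ¬(_ ∧ _ ∧ k = n - 1)), if_neg (by omega : ¬(_ ∧ _ ∧ k = n - 1))]
      split_ifs with h
      · simp [hqi i h.1]
      · simp

/-- `φ(K · K^m F^a h E^b)` picks a coefficient of `h` in the monomial basis. -/
theorem trace_picks_coord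
    (hφ : ∀ i j k, φ (monomial n q i j k) =
      if i ≡ 1 [MOD n] ∧ j = n - 1 ∧ k = n - 1 then 1 else 0) (h : Uq n q)
    (p : Fin n × Fin n × Fin n) :
    φ (K n q * (K n q ^ (n - p.1) * (F n q ^ (n - 1 - p.2.1) *
      (h * E n q ^ (n - 1 - p.2.2))))) =
      q⁻¹ ^ ((n - 1 - p.2.1) * p.1 : ℕ) * (monomialBasis hn hq).coord p h := by
  suffices H : φ ∘ₗ LinearMap.mulLeft ℂ (K n q) ∘ₗ LinearMap.mulLeft ℂ (K n q ^ (n - p.1 : ℕ)) ∘ₗ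
      LinearMap.mulLeft ℂ (F n q ^ (n - 1 - p.2.1 : ℕ)) ∘ₗ
      LinearMap.mulRight ℂ (E n q ^ (n - 1 - p.2.2 : ℕ)) =
      q⁻¹ ^ ((n - 1 - p.2.1) * p.1 : ℕ) • (monomialBasis hn hq).coord p from
    LinearMap.congr_fun H h
  refine (monomialBasis hn hq).ext fun p' => ?_
  simp only [LinearMap.comp_apply, LinearMap.mulLeft_apply, LinearMap.mulRight_apply,
    LinearMap.smul_apply, monomialBasis_apply, monomial_mul_E_pow, F_pow_mul_monomial,
    map_smul, K_pow_mul_monomial, K_mul_monomial, hφ, monomialBasis_coord_monomial]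
  obtain ⟨⟨i, hi⟩, ⟨j, hj⟩, ⟨k, hk⟩⟩ := p
  obtain ⟨⟨i', hi'⟩, ⟨j', hj'⟩, ⟨k', hk'⟩⟩ := p'
  simp only
  have e : (n - i + i' + 1 ≡ 1 [MOD n]) ↔ i' ≡ i [MOD n] := by
    constructor
    · intro h0
      have h1 := (Nat.ModEq.add_right_cancel' 1 (h0.trans (Nat.zero_add 1 ▸ Nat.ModEq.refl _))
        : n - i + i' ≡ 0 [MOD n]).add_left i
      rw [← add_assoc, Nat.add_sub_cancel' hi.le, add_zero] at h1
      exact (Nat.add_modEq_left (n := n)).symm.trans h1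
    · intro h0
      have h1 := (h0.add_left (n - i)).add_right 1
      rw [Nat.sub_add_cancel hi.le] at h1
      exact h1.trans Nat.add_modEq_left
  by_cases hc : i' ≡ i [MOD n] ∧ j' = j ∧ k' = k
  · obtain rfl : i' = i := Nat.ModEq.eq_of_lt_of_lt hc.1 hi' hi
    rw [if_pos hc, if_pos ⟨e.2 hc.1, by omega, by omega⟩]
  · rw [if_neg hc, if_neg, smul_zero, smul_zero]
    rintro ⟨h1, h2, h3⟩
    exact hc ⟨e.1 h1, by omega, by omega⟩

theorem isFrobeniusForm_twistedForm
    (hφ : ∀ i j k, φ (monomial n q i j k) =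
      if i ≡ 1 [MOD n] ∧ j = n - 1 ∧ k = n - 1 then 1 else 0) :
    IsFrobeniusForm (twistedForm φ (K n q)) where
  assoc a b c := by simp only [twistedForm, LinearMap.mk₂_apply, mul_assoc]
  bijective := by
    have : FiniteDimensional ℂ (Uq n q) := (monomialBasis hn hq).finiteDimensional_of_finite
    have hinj : Function.Injective (twistedForm φ (K n q)) := by
      refine (injective_iff_map_eq_zero _).2 fun h hh => ?_
      have hh' : ∀ g, φ (K n q * (h * g)) = 0 := fun g => by
        rw [← mul_assoc]
        exact LinearMap.congr_fun hh g
      refine (monomialBasis hn hq).ext_elem fun p => ?_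
      have h1 := trace_picks_coord hn hq hφ h p
      -- Cycling brings `h` to the front, so each coordinate of `h` is, up to a power of `q`, a
      -- value of `(h, ·)`, hence zero.
      rw [← mul_assoc (K n q ^ _), trace_comm hn hq hφ, mul_assoc h, hh'] at h1
      rw [map_zero, Finsupp.zero_apply]
      exact (mul_eq_zero.1 h1.symm).resolve_left
        (pow_ne_zero _ (inv_ne_zero (hq.ne_zero (by omega))))
    exact ⟨hinj, (LinearMap.injective_iff_surjective_of_finrank_eq_finrank
      Subspace.dual_finrank_eq.symm).1 hinj⟩

theorem isSymm_twistedForm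
    (hφ : ∀ i j k, φ (monomial n q i j k) =
      if i ≡ 1 [MOD n] ∧ j = n - 1 ∧ k = n - 1 then 1 else 0) :
    (twistedForm φ (K n q)).IsSymm :=
  ⟨fun x y => by
    simpa only [twistedForm, LinearMap.mk₂_apply, mul_assoc, RingHom.id_apply] using
      trace_comm hn hq hφ x y⟩

end

end Uq
end QuantumSL2

/-! ### Basis, integral and symmetric Frobenius form -/

theorem proposition3p8 (n : ℕ) (hn : 2 ≤ n) (q : ℂ) (hq : IsPrimitiveRoot q n) :
    letI := QuantumSL2.Uq.bialgebra hn hq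
    (∃ b : Module.Basis (Fin n × Fin n × Fin n) ℂ (QuantumSL2.Uq n q),
      ∀ i j k : Fin n, b (i, j, k) = QuantumSL2.Uq.K n q ^ (i : ℕ) *
        QuantumSL2.Uq.F n q ^ (j : ℕ) * QuantumSL2.Uq.E n q ^ (k : ℕ)) ∧
    (∃! φ : QuantumSL2.Uq n q →ₗ[ℂ] ℂ, QuantumSL2.IsHopfIntegral φ ∧
      φ (QuantumSL2.Uq.K n q * QuantumSL2.Uq.F n q ^ (n - 1) *
        QuantumSL2.Uq.E n q ^ (n - 1)) = 1) ∧
    ∀ φ : QuantumSL2.Uq n q →ₗ[ℂ] ℂ, QuantumSL2.IsHopfIntegral φ →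
      φ (QuantumSL2.Uq.K n q * QuantumSL2.Uq.F n q ^ (n - 1) *
        QuantumSL2.Uq.E n q ^ (n - 1)) = 1 →
      (∀ i j k : Fin n, φ (QuantumSL2.Uq.K n q ^ (i : ℕ) *
          QuantumSL2.Uq.F n q ^ (j : ℕ) * QuantumSL2.Uq.E n q ^ (k : ℕ)) =
        if (i : ℕ) = 1 ∧ (j : ℕ) = n - 1 ∧ (k : ℕ) = n - 1 then 1 else 0) ∧
      QuantumSL2.IsFrobeniusForm (QuantumSL2.twistedForm φ (QuantumSL2.Uq.K n q)) ∧
      (QuantumSL2.twistedForm φ (QuantumSL2.Uq.K n q)).IsSymm := by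
  let _ := QuantumSL2.Uq.bialgebra hn hq
  have hM : QuantumSL2.Uq.K n q * QuantumSL2.Uq.F n q ^ (n - 1) * QuantumSL2.Uq.E n q ^ (n - 1) =
      QuantumSL2.Uq.monomial n q 1 (n - 1) (n - 1) := by
    rw [QuantumSL2.Uq.monomial, pow_one]
  rw [hM]
  have hval : ∀ φ : QuantumSL2.Uq n q →ₗ[ℂ] ℂ, QuantumSL2.IsHopfIntegral φ →
      φ (QuantumSL2.Uq.monomial n q 1 (n - 1) (n - 1)) = 1 →
      ∀ i j k, φ (QuantumSL2.Uq.monomial n q i j k) =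
        if i ≡ 1 [MOD n] ∧ j = n - 1 ∧ k = n - 1 then 1 else 0 := fun φ hφ h1 =>
    QuantumSL2.Uq.integral_monomial hn hq ((QuantumSL2.Uq.isHopfIntegral_iff hn hq φ).1 hφ) h1
  refine ⟨⟨QuantumSL2.Uq.monomialBasis hn hq, fun i j k =>
    QuantumSL2.Uq.monomialBasis_apply hn hq (i, j, k)⟩, ?_, fun φ hφ h1 => ⟨fun i j k => ?_,
    QuantumSL2.Uq.isFrobeniusForm_twistedForm hn hq (hval φ hφ h1),
    QuantumSL2.Uq.isSymm_twistedForm hn hq (hval φ hφ h1)⟩⟩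
  -- The integral is the coordinate functional of `K F^(n-1) E^(n-1)`.
  · obtain ⟨φ, hφ⟩ := QuantumSL2.Uq.exists_functional hn hq 1 (n - 1) (n - 1) (by omega) (by omega)
    refine ⟨φ, ⟨(QuantumSL2.Uq.isHopfIntegral_iff hn hq φ).2
      (QuantumSL2.Uq.contractComul_eq_of_apply_monomial hn hq hφ), ?_⟩, fun ψ hψ => ?_⟩
    · rw [hφ, if_pos ⟨rfl, rfl, rfl⟩]
    · refine (QuantumSL2.Uq.monomialBasis hn hq).ext fun p => ?_
      rw [QuantumSL2.Uq.monomialBasis_apply, hφ, hval ψ hψ.1 hψ.2]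
  · have h := hval φ hφ h1 i j k
    rw [QuantumSL2.Uq.monomial] at h
    rw [h]
    congr 1
    rw [Nat.ModEq, Nat.mod_eq_of_lt i.2, Nat.mod_eq_of_lt hn]
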